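/- For a quadratic form $\Phi$ on $\mathbb{R}^{n\times m}$ put $\sigma(\Phi)(x,y)=\Phi(x\otimes y)$, where $x\otimes y=xy^T$. Call $\Phi$ \emph{quasiconvex} if $\int_{\mathbb{R}^m}\Phi(Z+\nabla\varphi(x))-\Phi(Z)\,dx\ge 0$ for all $Z\in\mathbb{R}^{n\times m}$ and all $\varphi\in C_c^\infty(\mathbb{R}^m,\mathbb{R}^n)$. Let $\mathrm{PB}_3$ be the convex cone of nonnegative biquadratic forms $F(x,y)$ on $\mathbb{R}^3\times\mathbb{R}^3$ (homogeneous of degree $2$ in $x$ and in $y$). An element $f\ne 0$ of a pointed convex cone $K$ \emph{spans an extreme ray} of $K$ if $f=f_1+f_2$ with $f_1,f_2\in K$ implies that $f_1,f_2$ are linearly dependent. A quadratic form $\Phi$ on $\mathbb{R}^{3\times 3}$ is a \emph{strong extremal} if $\sigma(\Phi)$ spans an extreme ray of $\mathrm{PB}_3$, and a \emph{weak extremal} if $\Phi(x\otimes y)\ge\langle x,My\rangle^2$ for all $x,y\in\mathbb{R}^3$ implies $M=0$. The \emph{acoustic tensor} of $\Phi$ is the symmetric matrix $T(x)$ of quadratic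 forms with $\Phi(x\otimes y)=\langle y,T(x)y\rangle$; the acoustic tensor in the other variable is the symmetric matrix $T'(y)$ of quadratic forms with $\Phi(x\otimes y)=\langle x,T'(y)x\rangle$. A \emph{Buckley--Šivic form} $f_{p,q}$ is a nonzero element of $\mathrm{PB}_3$ that vanishes at the nine points $(x;y)$ $$(1,1,1;1,1,1),\ (1,1,-1;1,1,-1),\ (1,-1,1;1,-1,1),\ (-1,1,1;-1,1,1),$$ $$(1,\pm p,0;\pm q,1,0),\ (0,1,\pm q;0,\pm p,1),\ (0,0,1;1,0,0)$$ (equal signs within each point). \textbf{Theorem.} (i) There is a quasiconvex quadratic form $\Phi$ on $\mathbb{R}^{3\times 3}$ such that $\sigma(\Phi)$ is a Buckley--Šivic form with $p=\tfrac12$, $q=\tfrac34$, every Buckley--Šivic form with these parameters is a positive multiple of $\sigma(\Phi)$, and $$T(x)=\begin{pmatrix}100x_0^2+192x_1^2&-222x_0x_1&-70x_0x_2\\-222x_0x_1&27x_0^2+225x_1^2+192x_2^2&-222x_1x_2\\-70x_0x_2&-222x_1x_2&165x_0^2+27x_1^2+100x_2^2\end{pmatrix};$$ this $\Phi$ is a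 strong extremal and a weak extremal, while $\det T(x)$ is a nonzero element of the convex cone of nonnegative real ternary sextics that does not span an extreme ray of that cone; the same holds for $\det T'(y)$. (ii) Consequently the following conjecture of Harutyunyan--Milton and Harutyunyan--Hovsepyan is false: for every quasiconvex quadratic form $\Phi$ on $\mathbb{R}^{3\times 3}$ that is a weak extremal with $\sigma(\Phi)\ne 0$, the determinant $\det T(x)$ of its acoustic tensor spans an extreme ray of the cone of nonnegative ternary sextics and is not a perfect square. -/

import Mathlib

open MeasureTheory
open scoped Matrix ContDiff

noncomputable section

namespace QuasiconvexForms

/-- The space of quadratic forms on real `n × m` matrices. -/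
abbrev Q (n m : ℕ) : Type := QuadraticForm ℝ (Matrix (Fin n) (Fin m) ℝ)

/-- The gradient matrix `(∂ⱼ φᵢ(x))ᵢⱼ` of a map `φ : ℝᵐ → ℝⁿ`. -/
def gradMatrix {n m : ℕ} (φ : EuclideanSpace ℝ (Fin m) → EuclideanSpace ℝ (Fin n))
    (x : EuclideanSpace ℝ (Fin m)) : Matrix (Fin n) (Fin m) ℝ :=
  Matrix.of fun i j => (fderiv ℝ φ x (EuclideanSpace.single j 1)) i

/-- Quasiconvexity (in the sense of Morrey) of a quadratic form on matrices:
`0 ≤ ∫ Φ(Z + ∇φ(x)) - Φ(Z) dx` for all matrices `Z` and all test functions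
`φ ∈ C_c^∞(ℝᵐ, ℝⁿ)`. The integrand is continuous with compact support. -/
def IsQuasiconvex {n m : ℕ} (Φ : Q n m) : Prop :=
  ∀ (Z : Matrix (Fin n) (Fin m) ℝ) (φ : EuclideanSpace ℝ (Fin m) → EuclideanSpace ℝ (Fin n)),
    ContDiff ℝ ∞ φ → HasCompactSupport φ →
      0 ≤ ∫ x, (Φ (Z + gradMatrix φ x) - Φ Z)

/-- Biquadratic forms on `ℝⁿ × ℝᵐ`. -/
def IsBiquadratic {n m : ℕ} (F : (Fin n → ℝ) → (Fin m → ℝ) → ℝ) : Prop :=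
  ∃ C : Fin n → Fin m → Fin n → Fin m → ℝ, ∀ x y,
    F x y = ∑ i, ∑ j, ∑ k, ∑ l, C i j k l * (x i * y j * x k * y l)

/-- The convex cone of nonnegative biquadratic forms on `ℝⁿ × ℝᵐ`. -/
def PB (n m : ℕ) : ConvexCone ℝ ((Fin n → ℝ) → (Fin m → ℝ) → ℝ) where
  carrier := {F | IsBiquadratic F ∧ ∀ x y, 0 ≤ F x y}
  smul_mem' := by
    rintro c hc F ⟨⟨C, hC⟩, hF⟩
    refine ⟨⟨fun i j k l => c * C i j k l, fun x y => ?_⟩, fun x y => ?_⟩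
    · simp only [Pi.smul_apply, smul_eq_mul, hC, Finset.mul_sum, mul_assoc]
    · exact mul_nonneg hc.le (hF x y)
  add_mem' := by
    rintro F ⟨⟨C, hC⟩, hF⟩ G ⟨⟨D, hD⟩, hG⟩
    refine ⟨⟨fun i j k l => C i j k l + D i j k l, fun x y => ?_⟩, fun x y => ?_⟩
    · simp only [Pi.add_apply, hC, hD, add_mul, Finset.sum_add_distrib]
    · exact add_nonneg (hF x y) (hG x y)

/-- The biquadratic form `σ(Φ)(x, y) = Φ(x ⊗ y)` of a quadratic form `Φ` on matrices. -/
def sigma {n m : ℕ} (Φ : Q n m) : (Fin n → ℝ) → (Fin m → ℝ) → ℝ :=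
  fun x y => Φ (Matrix.vecMulVec x y)

/-- `f` spans an extreme ray of the (pointed) convex cone `K`: it is a nonzero element of `K`, and
whenever `f = f₁ + f₂` with `f₁, f₂ ∈ K`, the elements `f₁, f₂` are linearly dependent. -/
def IsExtremeRay {E : Type*} [AddCommGroup E] [Module ℝ E] (K : ConvexCone ℝ E) (f : E) : Prop :=
  f ∈ K ∧ f ≠ 0 ∧ ∀ f₁ ∈ K, ∀ f₂ ∈ K, f = f₁ + f₂ → ¬ LinearIndependent ℝ ![f₁, f₂]

/-- Strong extremal quadratic forms: the biquadratic form `σ(Φ)` spans an extreme ray of the cone of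
nonnegative biquadratic forms. -/
def IsStrongExtremal {n m : ℕ} (Φ : Q n m) : Prop :=
  IsExtremeRay (PB n m) (sigma Φ)

/-- Weak extremal quadratic forms: no square `⟨x, M y⟩²` with `M ≠ 0` lies below `Φ(x ⊗ y)`. -/
def IsWeakExtremal {n m : ℕ} (Φ : Q n m) : Prop :=
  ∀ M : Matrix (Fin n) (Fin m) ℝ,
    (∀ x y, (x ⬝ᵥ M *ᵥ y) ^ 2 ≤ Φ (Matrix.vecMulVec x y)) → M = 0

/-- The coefficients `C i j k l = ⟨Eᵢⱼ, C Eₖₗ⟩` of the symmetric bilinear form of `Φ`. -/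
def coeffs {n m : ℕ} (Φ : Q n m) (i : Fin n) (j : Fin m) (k : Fin n) (l : Fin m) : ℝ :=
  QuadraticMap.polar Φ (Matrix.single i j 1) (Matrix.single k l 1) / 2

/-- The acoustic tensor (`x`-matrix) of `Φ`: the symmetric matrix `T(x)` of quadratic forms in the
variables `x` with `Φ(x ⊗ y) = ⟨y, T(x) y⟩`, namely `T(x)ⱼₗ = ∑ᵢₖ xᵢ C i j k l xₖ`. -/
def xMatrix {n m : ℕ} (Φ : Q n m) : Matrix (Fin m) (Fin m) (MvPolynomial (Fin n) ℝ) :=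
  Matrix.of fun j l =>
    ∑ i, ∑ k, MvPolynomial.C (coeffs Φ i j k l) * (MvPolynomial.X i * MvPolynomial.X k)

/-- The acoustic tensor in the other variable (`y`-matrix): the symmetric matrix `T(y)` of quadratic
forms in the variables `y` with `Φ(x ⊗ y) = ⟨x, T(y) x⟩`. -/
def yMatrix {n m : ℕ} (Φ : Q n m) : Matrix (Fin n) (Fin n) (MvPolynomial (Fin m) ℝ) :=
  Matrix.of fun i k =>
    ∑ j, ∑ l, MvPolynomial.C (coeffs Φ i j k l) * (MvPolynomial.X j * MvPolynomial.X l)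

/-- The convex cone of nonnegative real ternary sextics. -/
def ternarySextics : ConvexCone ℝ (MvPolynomial (Fin 3) ℝ) where
  carrier := {f | f.IsHomogeneous 6 ∧ ∀ x : Fin 3 → ℝ, 0 ≤ MvPolynomial.eval x f}
  smul_mem' := by
    rintro c hc f ⟨hf, hf0⟩
    refine ⟨?_, fun x => ?_⟩
    · rw [MvPolynomial.smul_eq_C_mul]
      simpa using (MvPolynomial.isHomogeneous_C (Fin 3) c).mul hf
    · rw [MvPolynomial.smul_eval]
      exact mul_nonneg hc.le (hf0 x)
  add_mem' := by
    rintro f ⟨hf, hf0⟩ g ⟨hg, hg0⟩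
    refine ⟨hf.add hg, fun x => ?_⟩
    rw [map_add]
    exact add_nonneg (hf0 x) (hg0 x)

/-- The nine prescribed points `(x; y)` of the Buckley–Šivic form with parameters `p, q`. -/
def nineZeros (p q : ℝ) : Set ((Fin 3 → ℝ) × (Fin 3 → ℝ)) :=
  {(![1, 1, 1], ![1, 1, 1]), (![1, 1, -1], ![1, 1, -1]), (![1, -1, 1], ![1, -1, 1]),
   (![-1, 1, 1], ![-1, 1, 1]), (![1, p, 0], ![q, 1, 0]), (![1, -p, 0], ![-q, 1, 0]),
   (![0, 1, q], ![0, p, 1]), (![0, 1, -q], ![0, -p, 1]), (![0, 0, 1], ![1, 0, 0])}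

/-- `F` is a Buckley–Šivic form `f_{p,q}`: a nonzero nonnegative biquadratic form in `(3, 3)`
variables that vanishes at the nine prescribed points. -/
def IsBuckleySivic (p q : ℝ) (F : (Fin 3 → ℝ) → (Fin 3 → ℝ) → ℝ) : Prop :=
  F ∈ PB 3 3 ∧ F ≠ 0 ∧ ∀ z ∈ nineZeros p q, F z.1 z.2 = 0

/-- The explicit matrix of quadratic forms that is the acoustic tensor `T(x)` of the Buckley–Šivic
form with `p = 1/2`, `q = 3/4`. -/
def exampleTensor : Matrix (Fin 3) (Fin 3) (MvPolynomial (Fin 3) ℝ) :=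
  let x : Fin 3 → MvPolynomial (Fin 3) ℝ := MvPolynomial.X
  !![100 * x 0 ^ 2 + 192 * x 1 ^ 2, -222 * x 0 * x 1, -70 * x 0 * x 2;
     -222 * x 0 * x 1, 27 * x 0 ^ 2 + 225 * x 1 ^ 2 + 192 * x 2 ^ 2, -222 * x 1 * x 2;
     -70 * x 0 * x 2, -222 * x 1 * x 2, 165 * x 0 ^ 2 + 27 * x 1 ^ 2 + 100 * x 2 ^ 2]

/-- The conjecture of Harutyunyan–Milton and Harutyunyan–Hovsepyan, for nontrivial forms: if a
quasiconvex quadratic form on `3 × 3` matrices with `σ(Φ) ≠ 0` is a weak extremal, then the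
determinant of its acoustic tensor spans an extreme ray of the cone of nonnegative ternary sextics
and is not a perfect square. -/
def DeterminantConjecture : Prop :=
  ∀ Φ : Q 3 3, IsQuasiconvex Φ → sigma Φ ≠ 0 → IsWeakExtremal Φ →
    IsExtremeRay ternarySextics (xMatrix Φ).det ∧ ¬ IsSquare (xMatrix Φ).det

end QuasiconvexForms

end

/-! The proof exhibits one explicit form, `exampleForm`, and every claim is checked on it. A
quadratic form that is nonnegative on rank-one matrices is quasiconvex: by Plancherel, the integral
of `Φ (∇φ)` is an integral of values of `Φ` on rank-one matrices (`isQuasiconvex_of_sigma_nonneg`).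
Nonnegativity of `sigma exampleForm` follows by completing squares with the leading principal minors
of the acoustic tensor, which reduces it to nonnegativity of the determinant.

The determinant is a cubic in the squares of the variables. The first components of the nine zeros
are zeros of it, and the cubic form `x₀ (x₀² - 4 x₁² + 3 x₂²)` passes through all nine. Subtracting
`900` times the square of that cubic form still leaves a nonnegative sextic (`reducedCubic_nonneg`),
so the determinant is a sum of two independent elements of the cone. A symmetry exchanging `x` and
`y` gives the same for the other tensor.

Extremality comes from rigidity. A nonnegative biquadratic form has zero gradient at each of its
zeros, and for the nine prescribed points the resulting linear equations on the 36 coefficients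
leave a single line of solutions (`eq_smul_of_forall_nineZeros`). The conjecture already fails in
its extreme-ray clause. -/

namespace QuasiconvexForms

open scoped SchwartzMap LineDeriv FourierTransform InnerProductSpace

/-! ### Quasiconvexity from rank-one nonnegativity. -/

/-- A linear functional on matrices in terms of its values on the matrix units. -/
theorem linear_apply_eq_sum {n m : ℕ} (L : Matrix (Fin n) (Fin m) ℝ →ₗ[ℝ] ℝ)
    (M : Matrix (Fin n) (Fin m) ℝ) : L M = ∑ i, ∑ j, L (Matrix.single i j 1) * M i j := by
  conv_lhs => rw [Matrix.matrix_eq_sum_single M]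
  simp only [map_sum]
  refine Finset.sum_congr rfl fun i _ => Finset.sum_congr rfl fun j _ => ?_
  rw [show Matrix.single i j (M i j) = M i j • Matrix.single i j (1 : ℝ) by
    simp [Matrix.smul_single], map_smul, smul_eq_mul, mul_comm]

/-- A quadratic form on matrices in terms of its coefficients. -/
theorem apply_eq_sum_coeffs {n m : ℕ} (Φ : Q n m) (M : Matrix (Fin n) (Fin m) ℝ) :
    Φ M = ∑ i, ∑ j, ∑ k, ∑ l, coeffs Φ i j k l * (M i j * M k l) := by
  have h1 : Φ M = Φ.polarBilin M M / 2 := by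
    rw [QuadraticMap.polarBilin_apply_apply, QuadraticMap.polar_self]
    simp
  rw [h1, ← LinearMap.flip_apply, linear_apply_eq_sum, Finset.sum_div]
  refine Finset.sum_congr rfl fun i _ => ?_
  rw [Finset.sum_div]
  refine Finset.sum_congr rfl fun j _ => ?_
  rw [LinearMap.flip_apply, linear_apply_eq_sum, Finset.sum_mul, Finset.sum_div]
  refine Finset.sum_congr rfl fun k _ => ?_
  rw [Finset.sum_mul, Finset.sum_div]
  refine Finset.sum_congr rfl fun l _ => ?_
  rw [QuadraticMap.polarBilin_apply_apply, coeffs]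
  ring

/-- The complexified `i`-th component of a test function. -/
noncomputable def component {n m : ℕ} {φ : EuclideanSpace ℝ (Fin m) → EuclideanSpace ℝ (Fin n)}
    (hφ : ContDiff ℝ ∞ φ) (hc : HasCompactSupport φ) (i : Fin n) :
    𝓢(EuclideanSpace ℝ (Fin m), ℂ) :=
  HasCompactSupport.toSchwartzMap (f := fun x => ((φ x i : ℝ) : ℂ))
    (hc.comp_left (g := fun v : EuclideanSpace ℝ (Fin n) => ((v i : ℝ) : ℂ)) (by simp))
    (Complex.ofRealCLM.contDiff.comp ((EuclideanSpace.proj (𝕜 := ℝ) i).contDiff.comp hφ))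

theorem lineDeriv_component {n m : ℕ}
    {φ : EuclideanSpace ℝ (Fin m) → EuclideanSpace ℝ (Fin n)}
    (hφ : ContDiff ℝ ∞ φ) (hc : HasCompactSupport φ) (i : Fin n) (j : Fin m)
    (x : EuclideanSpace ℝ (Fin m)) :
    (∂_{EuclideanSpace.single j (1 : ℝ)} (component hφ hc i)) x = (gradMatrix φ x i j : ℂ) := by
  rw [SchwartzMap.lineDerivOp_apply_eq_fderiv]
  have h1 : HasFDerivAt φ (fderiv ℝ φ x) x := (hφ.differentiable (by simp) x).hasFDerivAt
  have h2 := (Complex.ofRealCLM.hasFDerivAt (x := φ x i)).comp x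
    ((EuclideanSpace.proj (𝕜 := ℝ) i).hasFDerivAt.comp x h1)
  have h3 : fderiv ℝ (component hφ hc i) x = _ := HasFDerivAt.fderiv h2
  rw [h3]
  simp [gradMatrix]

theorem fourier_lineDeriv_apply {m : ℕ} (f : 𝓢(EuclideanSpace ℝ (Fin m), ℂ)) (j : Fin m)
    (ξ : EuclideanSpace ℝ (Fin m)) :
    𝓕 (∂_{EuclideanSpace.single j (1 : ℝ)} f) ξ = (2 * Real.pi * Complex.I) * (ξ j * 𝓕 f ξ) := by
  have h : (inner ℝ · (EuclideanSpace.single j (1 : ℝ))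
      : EuclideanSpace ℝ (Fin m) → ℝ).HasTemperateGrowth := by fun_prop
  rw [SchwartzMap.fourier_lineDerivOp_eq, smul_apply,
    SchwartzMap.smulLeftCLM_apply_apply h]
  simp [EuclideanSpace.inner_single_right]

theorem integrable_inner_schwartz {m : ℕ} (f g : 𝓢(EuclideanSpace ℝ (Fin m), ℂ)) :
    Integrable fun x => ⟪f x, g x⟫_ℂ := by
  have h := (SchwartzMap.pairing
    ((ContinuousLinearMap.mul ℝ ℂ).comp (Complex.conjCLE : ℂ →L[ℝ] ℂ)) f g).integrable
    (μ := volume)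
  refine h.congr (ae_of_all _ fun x => ?_)
  simp [SchwartzMap.pairing_apply_apply, mul_comm]

/-- The integral of a derivative of a compactly supported function vanishes. -/
theorem integral_gradMatrix_eq_zero {n m : ℕ}
    {φ : EuclideanSpace ℝ (Fin m) → EuclideanSpace ℝ (Fin n)}
    (hφ : ContDiff ℝ ∞ φ) (hc : HasCompactSupport φ) (i : Fin n) (j : Fin m) :
    Integrable (fun x => gradMatrix φ x i j) ∧ ∫ x, gradMatrix φ x i j = 0 := by
  set d := ∂_{EuclideanSpace.single j (1 : ℝ)} (component hφ hc i)
  have hd : ∀ x, d x = (gradMatrix φ x i j : ℂ) := lineDeriv_component hφ hc i j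
  have hint : Integrable fun x => d x := d.integrable
  refine ⟨by simpa [hd] using hint.re, ?_⟩
  -- Integration by parts against the constant function `1`.
  have h := integral_mul_fderiv_eq_neg_fderiv_mul_of_integrable (μ := volume)
    (f := fun _ : EuclideanSpace ℝ (Fin m) => (1 : ℂ)) (g := component hφ hc i)
    (v := EuclideanSpace.single j (1 : ℝ)) (by simp)
    (by simpa only [one_mul, ← SchwartzMap.lineDerivOp_apply_eq_fderiv] using hint)
    (by simpa using (component hφ hc i).integrable) (by simp)
    (fun x _ => (component hφ hc i).differentiableAt)
  simp only [one_mul, ← SchwartzMap.lineDerivOp_apply_eq_fderiv, lineDeriv_component,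
    integral_complex_ofReal] at h
  simpa using h

/-- A quadratic form on matrices that is nonnegative on rank-one matrices is quasiconvex. -/
theorem isQuasiconvex_of_sigma_nonneg {n m : ℕ} {Φ : Q n m} (h : ∀ x y, 0 ≤ sigma Φ x y) :
    IsQuasiconvex Φ := by
  intro Z φ hφ hc
  set d : Fin n → Fin m → 𝓢(EuclideanSpace ℝ (Fin m), ℂ) := fun i j =>
    ∂_{EuclideanSpace.single j (1 : ℝ)} (component hφ hc i) with hd
  have hdx : ∀ i j x, d i j x = (gradMatrix φ x i j : ℂ) := lineDeriv_component hφ hc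
  have hprod : ∀ i j k l x, gradMatrix φ x i j * gradMatrix φ x k l
      = (⟪d i j x, d k l x⟫_ℂ).re := by
    intro i j k l x
    simp [hdx, mul_comm]
  have hprodint : ∀ i j k l,
      Integrable fun x => gradMatrix φ x i j * gradMatrix φ x k l := by
    intro i j k l
    simp only [hprod]
    exact (integrable_inner_schwartz _ _).re
  have hplanch : ∀ i j k l, ∫ x, gradMatrix φ x i j * gradMatrix φ x k l
      = ∫ ξ, (⟪𝓕 (d i j) ξ, 𝓕 (d k l) ξ⟫_ℂ).re := by
    intro i j k l
    simp only [hprod]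
    have h1 := integral_re (integrable_inner_schwartz (d i j) (d k l))
    have h2 := integral_re (integrable_inner_schwartz (𝓕 (d i j)) (𝓕 (d k l)))
    simp only [RCLike.re_eq_complex_re] at h1 h2
    rw [h1, h2, SchwartzMap.integral_inner_fourier_fourier]
  have hquad : 0 ≤ ∫ x, Φ (gradMatrix φ x) := by
    have hI : ∀ i j k l, Integrable fun ξ =>
        coeffs Φ i j k l * (⟪𝓕 (d i j) ξ, 𝓕 (d k l) ξ⟫_ℂ).re := fun i j k l =>
      (integrable_inner_schwartz (𝓕 (d i j)) (𝓕 (d k l))).re.const_mul _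
    have heq : ∫ x, Φ (gradMatrix φ x) = ∫ ξ, ∑ i, ∑ j, ∑ k, ∑ l,
        coeffs Φ i j k l * (⟪𝓕 (d i j) ξ, 𝓕 (d k l) ξ⟫_ℂ).re := by
      simp_rw [apply_eq_sum_coeffs Φ (gradMatrix φ _)]
      have hJ : ∀ i j k l, Integrable fun x =>
          coeffs Φ i j k l * (gradMatrix φ x i j * gradMatrix φ x k l) := fun i j k l =>
        (hprodint i j k l).const_mul _
      rw [integral_finsetSum _ fun i _ => integrable_finsetSum _ fun j _ =>
          integrable_finsetSum _ fun k _ => integrable_finsetSum _ fun l _ => hJ i j k l,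
        integral_finsetSum _ fun i _ => integrable_finsetSum _ fun j _ =>
          integrable_finsetSum _ fun k _ => integrable_finsetSum _ fun l _ => hI i j k l]
      refine Finset.sum_congr rfl fun i _ => ?_
      rw [integral_finsetSum _ fun j _ =>
          integrable_finsetSum _ fun k _ => integrable_finsetSum _ fun l _ => hJ i j k l,
        integral_finsetSum _ fun j _ =>
          integrable_finsetSum _ fun k _ => integrable_finsetSum _ fun l _ => hI i j k l]
      refine Finset.sum_congr rfl fun j _ => ?_
      rw [integral_finsetSum _ fun k _ => integrable_finsetSum _ fun l _ => hJ i j k l,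
        integral_finsetSum _ fun k _ => integrable_finsetSum _ fun l _ => hI i j k l]
      refine Finset.sum_congr rfl fun k _ => ?_
      rw [integral_finsetSum _ fun l _ => hJ i j k l, integral_finsetSum _ fun l _ => hI i j k l]
      refine Finset.sum_congr rfl fun l _ => ?_
      rw [integral_const_mul, integral_const_mul, hplanch]
    rw [heq]
    refine integral_nonneg fun ξ => ?_
    -- At each frequency the transformed gradient is `2πi` times the rank-one matrix with entries
    -- `φ̂ᵢ(ξ) ξⱼ`. The factor `i` drops out of the Hermitian product, and the real and imaginary
    -- parts of `φ̂` contribute separately.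
    have hsum : ∑ i, ∑ j, ∑ k, ∑ l,
        coeffs Φ i j k l * (⟪𝓕 (d i j) ξ, 𝓕 (d k l) ξ⟫_ℂ).re
        = sigma Φ (fun i => 2 * Real.pi * (𝓕 (component hφ hc i) ξ).re) ξ
          + sigma Φ (fun i => 2 * Real.pi * (𝓕 (component hφ hc i) ξ).im) ξ := by
      simp only [sigma, apply_eq_sum_coeffs Φ (Matrix.vecMulVec _ _), ← Finset.sum_add_distrib]
      refine Finset.sum_congr rfl fun i _ => Finset.sum_congr rfl fun j _ =>
        Finset.sum_congr rfl fun k _ => Finset.sum_congr rfl fun l _ => ?_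
      rw [← mul_add]
      congr 1
      simp only [hd, fourier_lineDeriv_apply]
      simp [Matrix.vecMulVec_apply]
      ring
    rw [Pi.zero_apply, hsum]
    exact add_nonneg (h _ _) (h _ _)
  have hquadint : Integrable fun x => Φ (gradMatrix φ x) := by
    simp_rw [apply_eq_sum_coeffs Φ (gradMatrix φ _)]
    exact integrable_finsetSum _ fun i _ => integrable_finsetSum _ fun j _ =>
      integrable_finsetSum _ fun k _ => integrable_finsetSum _ fun l _ =>
        (hprodint i j k l).const_mul _
  have hlin : ∀ x, QuadraticMap.polar Φ Z (gradMatrix φ x) = ∑ i, ∑ j,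
      QuadraticMap.polar Φ Z (Matrix.single i j 1) * gradMatrix φ x i j := by
    intro x
    rw [← QuadraticMap.polarBilin_apply_apply, linear_apply_eq_sum]
    simp only [QuadraticMap.polarBilin_apply_apply]
  have hg := integral_gradMatrix_eq_zero hφ hc
  have hlinint : Integrable fun x => QuadraticMap.polar Φ Z (gradMatrix φ x) := by
    simp only [hlin]
    exact integrable_finsetSum _ fun i _ => integrable_finsetSum _ fun j _ =>
      (hg i j).1.const_mul _
  have hlin0 : ∫ x, QuadraticMap.polar Φ Z (gradMatrix φ x) = 0 := by
    simp only [hlin]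
    rw [integral_finsetSum _ fun i _ => integrable_finsetSum _ fun j _ => (hg i j).1.const_mul _]
    refine Finset.sum_eq_zero fun i _ => ?_
    rw [integral_finsetSum _ fun j _ => (hg i j).1.const_mul _]
    refine Finset.sum_eq_zero fun j _ => ?_
    rw [integral_const_mul, (hg i j).2, mul_zero]
  have hsplit : ∀ x, Φ (Z + gradMatrix φ x) - Φ Z
      = Φ (gradMatrix φ x) + QuadraticMap.polar Φ Z (gradMatrix φ x) := by
    intro x
    simp only [QuadraticMap.polar]
    ring
  simp only [hsplit]
  rw [integral_add hquadint hlinint, hlin0, add_zero]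
  exact hquad

/-! ### The explicit form and its two acoustic tensors. -/

/-- The matrix `E ↦ E i j * E k l`, as a quadratic form. -/
def entryMul (i j k l : Fin 3) : Q 3 3 :=
  QuadraticMap.linMulLin (Matrix.entryLinearMap ℝ ℝ i j) (Matrix.entryLinearMap ℝ ℝ k l)

/-- A quadratic form whose acoustic tensor is `exampleTensor`. -/
def exampleForm : Q 3 3 :=
  (100 : ℝ) • entryMul 0 0 0 0 + (192 : ℝ) • entryMul 1 0 1 0 + (27 : ℝ) • entryMul 0 1 0 1
    + (225 : ℝ) • entryMul 1 1 1 1 + (192 : ℝ) • entryMul 2 1 2 1 + (165 : ℝ) • entryMul 0 2 0 2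
    + (27 : ℝ) • entryMul 1 2 1 2 + (100 : ℝ) • entryMul 2 2 2 2
    -- Each off-diagonal entry of the tensor occurs twice in `⟨y, T(x) y⟩`, hence twice `222` and
    -- `70`. Placing the cross terms on diagonal entries is a choice: adding multiples of `2 × 2`
    -- minors changes neither `sigma` nor the tensors.
    - (444 : ℝ) • entryMul 0 0 1 1 - (140 : ℝ) • entryMul 0 0 2 2 - (444 : ℝ) • entryMul 1 1 2 2

theorem exampleForm_apply (M : Matrix (Fin 3) (Fin 3) ℝ) :
    exampleForm M = 100 * M 0 0 ^ 2 + 192 * M 1 0 ^ 2 + 27 * M 0 1 ^ 2 + 225 * M 1 1 ^ 2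
      + 192 * M 2 1 ^ 2 + 165 * M 0 2 ^ 2 + 27 * M 1 2 ^ 2 + 100 * M 2 2 ^ 2
      - 444 * (M 0 0 * M 1 1) - 140 * (M 0 0 * M 2 2) - 444 * (M 1 1 * M 2 2) := by
  simp [exampleForm, entryMul, sub_eq_add_neg]
  ring

theorem sigma_exampleForm (x y : Fin 3 → ℝ) :
    sigma exampleForm x y = 100 * (x 0 * y 0) ^ 2 + 192 * (x 1 * y 0) ^ 2 + 27 * (x 0 * y 1) ^ 2
      + 225 * (x 1 * y 1) ^ 2 + 192 * (x 2 * y 1) ^ 2 + 165 * (x 0 * y 2) ^ 2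
      + 27 * (x 1 * y 2) ^ 2 + 100 * (x 2 * y 2) ^ 2
      - 444 * (x 0 * y 0 * (x 1 * y 1)) - 140 * (x 0 * y 0 * (x 2 * y 2))
      - 444 * (x 1 * y 1 * (x 2 * y 2)) := by
  simp only [sigma, exampleForm_apply, Matrix.vecMulVec_apply]

theorem coeffs_exampleForm (i j k l : Fin 3) :
    coeffs exampleForm i j k l = (exampleForm (Matrix.single i j 1 + Matrix.single k l 1)
      - exampleForm (Matrix.single i j 1) - exampleForm (Matrix.single k l 1)) / 2 := rfl

theorem xMatrix_exampleForm : xMatrix exampleForm = exampleTensor := by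
  ext1 j l
  fin_cases j <;> fin_cases l <;>
    simp [xMatrix, exampleTensor, Fin.sum_univ_three, coeffs_exampleForm, exampleForm_apply,
      Matrix.single_apply]
  all_goals norm_num
  all_goals simp only [map_ofNat]
  all_goals ring

/-- The acoustic tensor of `exampleForm` in the other variable. -/
noncomputable def exampleTensor' : Matrix (Fin 3) (Fin 3) (MvPolynomial (Fin 3) ℝ) :=
  let y : Fin 3 → MvPolynomial (Fin 3) ℝ := MvPolynomial.X
  !![100 * y 0 ^ 2 + 27 * y 1 ^ 2 + 165 * y 2 ^ 2, -222 * y 0 * y 1, -70 * y 0 * y 2;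
     -222 * y 0 * y 1, 192 * y 0 ^ 2 + 225 * y 1 ^ 2 + 27 * y 2 ^ 2, -222 * y 1 * y 2;
     -70 * y 0 * y 2, -222 * y 1 * y 2, 192 * y 1 ^ 2 + 100 * y 2 ^ 2]

theorem yMatrix_exampleForm : yMatrix exampleForm = exampleTensor' := by
  ext1 j l
  fin_cases j <;> fin_cases l <;>
    simp [yMatrix, exampleTensor', Fin.sum_univ_three, coeffs_exampleForm, exampleForm_apply,
      Matrix.single_apply]
  all_goals norm_num
  all_goals simp only [map_ofNat]
  all_goals ring

/-! ### Nonnegativity of the determinant and of the form. -/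

/-- The even ternary sextic `det T(x)`, divided by `900` and with the square
`(x₀ (x₀² - 4 x₁² + 3 x₂²))²` subtracted, as a cubic form in the squares of the variables. -/
def reducedCubic (a b c : ℝ) : ℝ :=
  494 * a ^ 3 - 3871 * a ^ 2 * b + 3667 * a ^ 2 * c + 7256 * a * b ^ 2 - 9409 * a * b * c
    + 1079 * a * c ^ 2 + 1296 * b ^ 3 - 4608 * b ^ 2 * c + 4096 * b * c ^ 2

/-- As a quadratic `P c² + S c + R` in `c`, it has nonnegative `P` and `R`, so only `S < 0` needs an
argument. There the ratio `a / b` is small enough to make the discriminant nonpositive. -/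
theorem reducedCubic_nonneg {a b c : ℝ} (ha : 0 ≤ a) (hb : 0 ≤ b) (hc : 0 ≤ c) :
    0 ≤ reducedCubic a b c := by
  set P := 1079 * a + 4096 * b with hP
  set S := 3667 * a ^ 2 - 9409 * a * b - 4608 * b ^ 2 with hS
  set R := (a - 4 * b) ^ 2 * (494 * a + 81 * b) with hR
  have hdec : reducedCubic a b c = P * c ^ 2 + S * c + R := by
    rw [hP, hS, hR, reducedCubic]
    ring
  have hP0 : 0 ≤ P := by positivity
  have hR0 : 0 ≤ R := by positivity
  rw [hdec]
  rcases le_or_gt 0 S with h | h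
  · positivity
  -- The bound `3.1` lies between the positive root of `S` in `a / b`, about `2.99`, and the ratio
  -- `37762496 / 11314785`, about `3.34`, at which the last factor of `hdisc` changes sign.
  · have hab : a ≤ 3.1 * b := by
      by_contra! hcon
      nlinarith [mul_nonneg ha hb, mul_nonneg hb hb]
    have hPpos : 0 < P := by
      rcases hP0.lt_or_eq with h1 | h1
      · exact h1
      · have ha0 : a = 0 := by linarith
        have hb0 : b = 0 := by linarith
        simp [hS, ha0, hb0] at h
    have hdisc : 4 * P * R - S ^ 2
        = a * (a - b) ^ 2 * (37762496 * b - 11314785 * a) := by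
      rw [hP, hS, hR]
      ring
    have h0 : 0 ≤ 4 * P * R - S ^ 2 := by
      rw [hdisc]
      have : 0 ≤ 37762496 * b - 11314785 * a := by linarith
      positivity
    have h4 : 0 ≤ 4 * P * (P * c ^ 2 + S * c + R) := by
      nlinarith [sq_nonneg (2 * P * c + S)]
    exact nonneg_of_mul_nonneg_right h4 (by positivity)

/-- The determinant of the acoustic tensor at `x`, in terms of the squares of the coordinates. -/
def detCubic (a b c : ℝ) : ℝ :=
  900 * (reducedCubic a b c + a * (a - 4 * b + 3 * c) ^ 2)

theorem detCubic_nonneg {a b c : ℝ} (ha : 0 ≤ a) (hb : 0 ≤ b) (hc : 0 ≤ c) :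
    0 ≤ detCubic a b c := by
  have := reducedCubic_nonneg ha hb hc
  rw [detCubic]
  positivity

/-- Here `p` and `m` are the leading principal minors of `T(x)` of orders one and two; multiplying
by them clears the denominators in the completion of squares in `y`. Points where a minor vanishes
are treated separately. -/
theorem sigma_exampleForm_nonneg (x y : Fin 3 → ℝ) : 0 ≤ sigma exampleForm x y := by
  rw [sigma_exampleForm]
  generalize x 0 = u, x 1 = v, x 2 = w, y 0 = r, y 1 = s, y 2 = t
  set p := 100 * u ^ 2 + 192 * v ^ 2 with hp
  set m := 2700 * (u ^ 2 - 4 * v ^ 2) ^ 2 + 19200 * (u * w) ^ 2 + 36864 * (v * w) ^ 2 with hm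
  have hp0 : 0 ≤ p := by positivity
  have hm0 : 0 ≤ m := by positivity
  rcases hp0.eq_or_lt with h | h
  · have hu : u = 0 := by nlinarith [sq_nonneg u, sq_nonneg v]
    have hv : v = 0 := by nlinarith [sq_nonneg u, sq_nonneg v]
    subst hu hv
    have : 0 ≤ 192 * (w * s) ^ 2 + 100 * (w * t) ^ 2 := by positivity
    linarith
  refine nonneg_of_mul_nonneg_right ?_ h
  -- For `w = 0` the minor `m` can vanish, at `u² = 4 v²`, but then `t` decouples from `r` and `s`.
  by_cases hw : w = 0
  · subst hw
    have : 0 ≤ (p * r - 222 * u * v * s) ^ 2 + m * s ^ 2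
        + p * (165 * u ^ 2 + 27 * v ^ 2) * t ^ 2 := by positivity
    convert! this using 1
    rw [hp, hm]
    ring
  have hmpos : 0 < m := by
    have h1 : 0 < 19200 * (u * w) ^ 2 + 36864 * (v * w) ^ 2 := by
      have : 0 < p * w ^ 2 := by positivity
      nlinarith [sq_nonneg (v * w)]
    have : 0 ≤ 2700 * (u ^ 2 - 4 * v ^ 2) ^ 2 := by positivity
    linarith
  refine nonneg_of_mul_nonneg_right ?_ hmpos
  have hd := detCubic_nonneg (sq_nonneg u) (sq_nonneg v) (sq_nonneg w)
  -- This sum equals `m * p * sigma`; the coefficient of the last square is `p` times the full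
  -- determinant.
  have : 0 ≤ m * (p * r - 222 * u * v * s - 70 * u * w * t) ^ 2
      + (m * s - (222 * v * w * p + 15540 * u ^ 2 * v * w) * t) ^ 2
      + p * detCubic (u ^ 2) (v ^ 2) (w ^ 2) * t ^ 2 := by positivity
  convert! this using 1
  rw [hp, hm, detCubic, reducedCubic]
  ring

/-! ### The determinants in the cone of ternary sextics. -/

open MvPolynomial in
theorem isHomogeneous_det {M : Matrix (Fin 3) (Fin 3) (MvPolynomial (Fin 3) ℝ)}
    (h : ∀ i j, (M i j).IsHomogeneous 2) : M.det.IsHomogeneous 6 := by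
  rw [Matrix.det_apply]
  refine IsHomogeneous.sum _ _ _ fun s _ => ?_
  have hp : (∏ i, M (s i) i).IsHomogeneous (∑ _i : Fin 3, 2) :=
    IsHomogeneous.prod _ _ _ fun i _ => h _ _
  rcases Int.units_eq_one_or (Equiv.Perm.sign s) with h1 | h1
  · simpa [h1] using hp
  · simpa [h1] using hp.neg

open MvPolynomial in
theorem isHomogeneous_xMatrix {n m : ℕ} (Φ : Q n m) (j l : Fin m) :
    (xMatrix Φ j l).IsHomogeneous 2 := by
  rw [xMatrix, Matrix.of_apply]
  refine IsHomogeneous.sum _ _ _ fun i _ => ?_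
  refine IsHomogeneous.sum _ _ _ fun k _ => ?_
  simpa using (isHomogeneous_C (Fin n) (coeffs Φ i j k l)).mul
    ((isHomogeneous_X ℝ i).mul (isHomogeneous_X ℝ k))

open MvPolynomial in
theorem isHomogeneous_yMatrix {n m : ℕ} (Φ : Q n m) (i k : Fin n) :
    (yMatrix Φ i k).IsHomogeneous 2 := by
  rw [yMatrix, Matrix.of_apply]
  refine IsHomogeneous.sum _ _ _ fun j _ => ?_
  refine IsHomogeneous.sum _ _ _ fun l _ => ?_
  simpa using (isHomogeneous_C (Fin m) (coeffs Φ i j k l)).mul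
    ((isHomogeneous_X ℝ j).mul (isHomogeneous_X ℝ l))

theorem eval_det_exampleTensor (x : Fin 3 → ℝ) :
    MvPolynomial.eval x exampleTensor.det = detCubic (x 0 ^ 2) (x 1 ^ 2) (x 2 ^ 2) := by
  simp [exampleTensor, Matrix.det_fin_three, detCubic, reducedCubic]
  ring

/-- The form is invariant under exchanging `xᵢ` with `y₂₋ᵢ`, so the same cubic appears with its
arguments reversed. -/
theorem eval_det_exampleTensor' (y : Fin 3 → ℝ) :
    MvPolynomial.eval y exampleTensor'.det = detCubic (y 2 ^ 2) (y 1 ^ 2) (y 0 ^ 2) := by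
  simp [exampleTensor', Matrix.det_fin_three, detCubic, reducedCubic]
  ring

/-- A sextic that dominates the square of a nonzero cubic, and is not a multiple of it, does not
span an extreme ray. -/
theorem not_isExtremeRay_of_sq_le {f g : MvPolynomial (Fin 3) ℝ} (hf : f.IsHomogeneous 6)
    (hg : g.IsHomogeneous 3)
    (h : ∀ x : Fin 3 → ℝ, MvPolynomial.eval x g ^ 2 ≤ MvPolynomial.eval x f)
    {z w : Fin 3 → ℝ} (hz : MvPolynomial.eval z g = 0) (hz' : MvPolynomial.eval z f ≠ 0)
    (hw : MvPolynomial.eval w g ≠ 0) : ¬ IsExtremeRay ternarySextics f := by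
  intro hext
  have hg2 : (g ^ 2).IsHomogeneous 6 := hg.pow 2
  -- The forbidden decomposition is `f = g² + (f - g²)`. In a linear relation, evaluation at `z`
  -- kills the second coefficient, and then evaluation at `w` kills the first.
  refine hext.2.2 (g ^ 2) ⟨hg2, fun x => ?_⟩ (f - g ^ 2) ⟨hf.sub hg2, fun x => ?_⟩ (by ring) ?_
  · rw [map_pow]
    positivity
  · rw [map_sub, map_pow]
    exact sub_nonneg.2 (h x)
  · rw [LinearIndependent.pair_iff]
    intro s t hst
    have key : ∀ x : Fin 3 → ℝ, s * MvPolynomial.eval x g ^ 2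
        + t * (MvPolynomial.eval x f - MvPolynomial.eval x g ^ 2) = 0 := fun x => by
      simpa [MvPolynomial.smul_eval] using congrArg (MvPolynomial.eval x) hst
    have ht : t = 0 := by simpa [hz, hz'] using key z
    subst ht
    exact ⟨by simpa [hw] using key w, rfl⟩

open MvPolynomial in
/-- A ternary sextic whose values are those of `detCubic` at the squares of the variables is a
nonzero element of the cone of nonnegative sextics that does not span an extreme ray. -/
theorem not_isExtremeRay_of_eval_eq_detCubic {f : MvPolynomial (Fin 3) ℝ} (hf : f.IsHomogeneous 6)
    {i j k : Fin 3} (hij : i ≠ j) (hjk : j ≠ k) (hik : i ≠ k)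
    (h : ∀ x : Fin 3 → ℝ, eval x f = detCubic (x i ^ 2) (x j ^ 2) (x k ^ 2)) :
    f ∈ ternarySextics ∧ f ≠ 0 ∧ ¬ IsExtremeRay ternarySextics f := by
  have hpos : ∀ x, 0 ≤ eval x f := fun x => by
    rw [h]
    exact detCubic_nonneg (sq_nonneg _) (sq_nonneg _) (sq_nonneg _)
  have hne : eval (Pi.single j 1) f ≠ 0 := by
    simp [h, hij, hjk.symm, detCubic, reducedCubic]
  refine ⟨⟨hf, hpos⟩, fun h0 => hne (by simp [h0]), ?_⟩
  refine not_isExtremeRay_of_sq_le hf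
    -- The factor `30` is the square root of the `900` in `detCubic`. The cubic vanishes at the
    -- `j`-th unit vector, where the sextic does not, and is nonzero at the `i`-th.
    (g := C 30 * (X i * (X i ^ 2 + C (-4) * X j ^ 2 + C 3 * X k ^ 2))) ?_ ?_
    (z := Pi.single j 1) (w := Pi.single i 1) ?_ hne ?_
  · have h2 : ∀ l : Fin 3, (X l ^ 2 : MvPolynomial (Fin 3) ℝ).IsHomogeneous 2 := fun l => by
      simpa using (isHomogeneous_X ℝ l).pow 2
    have h3 : ∀ (r : ℝ) (l : Fin 3), (C r * X l ^ 2).IsHomogeneous 2 := fun r l => by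
      simpa using (isHomogeneous_C _ r).mul (h2 l)
    simpa using (isHomogeneous_C _ (30 : ℝ)).mul
      ((isHomogeneous_X ℝ i).mul (((h2 i).add (h3 (-4) j)).add (h3 3 k)))
  · intro x
    have := reducedCubic_nonneg (sq_nonneg (x i)) (sq_nonneg (x j)) (sq_nonneg (x k))
    rw [h, detCubic]
    simp only [map_mul, map_add, map_pow, eval_C, eval_X]
    linarith
  · simp [hij]
  · simp [hij, hik]

/-! ### Vanishing gradients at zeros and the resulting linear system. -/

theorem linear_coeff_eq_zero_of_forall_nonneg {A B : ℝ}
    (h : ∀ t : ℝ, 0 ≤ t * B + t ^ 2 * A) : B = 0 := by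
  have h1 : ∀ t : ℝ, 0 ≤ A * (t * t) + B * t + 0 := fun t => by
    have := h t
    linarith
  have h2 := discrim_le_zero h1
  rw [discrim] at h2
  nlinarith

/-- The derivative in the first variable of a nonnegative biquadratic form vanishes at a zero. -/
theorem PB.add_left_eq_sub_left_of_eq_zero {n m : ℕ}
    {F : (Fin n → ℝ) → (Fin m → ℝ) → ℝ} (hF : F ∈ PB n m)
    {x : Fin n → ℝ} {y : Fin m → ℝ} (h0 : F x y = 0) (u : Fin n → ℝ) :
    F (x + u) y = F (x - u) y := by
  obtain ⟨⟨C, hC⟩, hpos⟩ := hF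
  -- Along a line in the first variable the form is a quadratic polynomial in `t`, and its linear
  -- coefficient is the symmetric difference quotient.
  have key : ∀ t : ℝ, F (x + t • u) y
      = F x y + t * ((F (x + u) y - F (x - u) y) / 2) + t ^ 2 * F u y := by
    intro t
    simp only [hC, Finset.mul_sum, Finset.sum_div, ← Finset.sum_add_distrib,
      ← Finset.sum_sub_distrib]
    refine Finset.sum_congr rfl fun i _ => Finset.sum_congr rfl fun j _ =>
      Finset.sum_congr rfl fun k _ => Finset.sum_congr rfl fun l _ => ?_
    simp only [Pi.add_apply, Pi.sub_apply, Pi.smul_apply, smul_eq_mul]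
    ring
  have h := linear_coeff_eq_zero_of_forall_nonneg (A := F u y)
    (B := (F (x + u) y - F (x - u) y) / 2) fun t => by
    have := hpos (x + t • u) y
    rwa [key, h0, zero_add] at this
  linarith

/-- The derivative in the second variable of a nonnegative biquadratic form vanishes at a zero. -/
theorem PB.add_right_eq_sub_right_of_eq_zero {n m : ℕ}
    {F : (Fin n → ℝ) → (Fin m → ℝ) → ℝ} (hF : F ∈ PB n m)
    {x : Fin n → ℝ} {y : Fin m → ℝ} (h0 : F x y = 0) (v : Fin m → ℝ) :
    F x (y + v) = F x (y - v) := by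
  obtain ⟨⟨C, hC⟩, hpos⟩ := hF
  have hswap : (fun y x => F x y) ∈ PB m n := by
    refine ⟨⟨fun j i l k => C i j k l, fun y x => ?_⟩, fun y x => hpos x y⟩
    change F x y = _
    rw [hC, Finset.sum_comm]
    refine Finset.sum_congr rfl fun j _ => Finset.sum_congr rfl fun i _ => ?_
    rw [Finset.sum_comm]
    refine Finset.sum_congr rfl fun l _ => Finset.sum_congr rfl fun k _ => ?_
    ring
  exact PB.add_left_eq_sub_left_of_eq_zero hswap h0 v

/-- The ternary quadratic form with the given coefficients. -/
def ternaryQuad (a : Fin 6 → ℝ) (x0 x1 x2 : ℝ) : ℝ :=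
  a 0 * x0 ^ 2 + a 1 * (x0 * x1) + a 2 * (x0 * x2) + a 3 * x1 ^ 2 + a 4 * (x1 * x2) + a 5 * x2 ^ 2

/-- A biquadratic form on `ℝ³ × ℝ³` in terms of the products of quadratic monomials. -/
theorem IsBiquadratic.exists_coeffs {F : (Fin 3 → ℝ) → (Fin 3 → ℝ) → ℝ} (hF : IsBiquadratic F) :
    ∃ D : Fin 6 → Fin 6 → ℝ, ∀ x0 x1 x2 y0 y1 y2, F ![x0, x1, x2] ![y0, y1, y2] =
      ternaryQuad (fun i => ternaryQuad (D i) y0 y1 y2) x0 x1 x2 := by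
  obtain ⟨C, hC⟩ := hF
  -- Rows and columns follow the monomial order of `ternaryQuad`: `00, 01, 02, 11, 12, 22`.
  -- Coefficients of equal monomials are collected.
  refine ⟨
    ![![C 0 0 0 0, C 0 0 0 1 + C 0 1 0 0, C 0 0 0 2 + C 0 2 0 0, C 0 1 0 1, C 0 1 0 2 + C 0 2 0 1,
      C 0 2 0 2],
    ![C 0 0 1 0 + C 1 0 0 0, C 0 0 1 1 + C 0 1 1 0 + C 1 0 0 1 + C 1 1 0 0, C 0 0 1 2 +
      C 0 2 1 0 + C 1 0 0 2 + C 1 2 0 0, C 0 1 1 1 + C 1 1 0 1, C 0 1 1 2 + C 0 2 1 1 + C 1 1 0 2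
      + C 1 2 0 1, C 0 2 1 2 + C 1 2 0 2],
    ![C 0 0 2 0 + C 2 0 0 0, C 0 0 2 1 + C 0 1 2 0 + C 2 0 0 1 + C 2 1 0 0, C 0 0 2 2 +
      C 0 2 2 0 + C 2 0 0 2 + C 2 2 0 0, C 0 1 2 1 + C 2 1 0 1, C 0 1 2 2 + C 0 2 2 1 + C 2 1 0 2
      + C 2 2 0 1, C 0 2 2 2 + C 2 2 0 2],
    ![C 1 0 1 0, C 1 0 1 1 + C 1 1 1 0, C 1 0 1 2 + C 1 2 1 0, C 1 1 1 1, C 1 1 1 2 + C 1 2 1 1,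
      C 1 2 1 2],
    ![C 1 0 2 0 + C 2 0 1 0, C 1 0 2 1 + C 1 1 2 0 + C 2 0 1 1 + C 2 1 1 0, C 1 0 2 2 +
      C 1 2 2 0 + C 2 0 1 2 + C 2 2 1 0, C 1 1 2 1 + C 2 1 1 1, C 1 1 2 2 + C 1 2 2 1 + C 2 1 1 2
      + C 2 2 1 1, C 1 2 2 2 + C 2 2 1 2],
    ![C 2 0 2 0, C 2 0 2 1 + C 2 1 2 0, C 2 0 2 2 + C 2 2 2 0, C 2 1 2 1, C 2 1 2 2 + C 2 2 2 1,
      C 2 2 2 2]], fun x0 x1 x2 y0 y1 y2 => ?_⟩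
  rw [hC]
  simp only [Fin.sum_univ_three, Matrix.cons_val, ternaryQuad]
  ring

/-- The gradient of a nonnegative biquadratic form vanishes at its zeros. -/
theorem exists_coeffs_and_gradient {F : (Fin 3 → ℝ) → (Fin 3 → ℝ) → ℝ} (hF : F ∈ PB 3 3)
    {S : Set ((Fin 3 → ℝ) × (Fin 3 → ℝ))} (h0 : ∀ z ∈ S, F z.1 z.2 = 0) :
    ∃ D : Fin 6 → Fin 6 → ℝ, (∀ x0 x1 x2 y0 y1 y2, F ![x0, x1, x2] ![y0, y1, y2] =
      ternaryQuad (fun i => ternaryQuad (D i) y0 y1 y2) x0 x1 x2) ∧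
    (∀ x0 x1 x2 y0 y1 y2, (![x0, x1, x2], ![y0, y1, y2]) ∈ S →
      2 * x0 * ternaryQuad (D 0) y0 y1 y2 + x1 * ternaryQuad (D 1) y0 y1 y2
        + x2 * ternaryQuad (D 2) y0 y1 y2 = 0) ∧
    (∀ x0 x1 x2 y0 y1 y2, (![x0, x1, x2], ![y0, y1, y2]) ∈ S →
      x0 * ternaryQuad (D 1) y0 y1 y2 + 2 * x1 * ternaryQuad (D 3) y0 y1 y2
        + x2 * ternaryQuad (D 4) y0 y1 y2 = 0) ∧
    (∀ x0 x1 x2 y0 y1 y2, (![x0, x1, x2], ![y0, y1, y2]) ∈ S →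
      x0 * ternaryQuad (D 2) y0 y1 y2 + x1 * ternaryQuad (D 4) y0 y1 y2
        + 2 * x2 * ternaryQuad (D 5) y0 y1 y2 = 0) ∧
    (∀ x0 x1 x2 y0 y1 y2, (![x0, x1, x2], ![y0, y1, y2]) ∈ S →
      2 * y0 * ternaryQuad (D · 0) x0 x1 x2 + y1 * ternaryQuad (D · 1) x0 x1 x2
        + y2 * ternaryQuad (D · 2) x0 x1 x2 = 0) ∧
    (∀ x0 x1 x2 y0 y1 y2, (![x0, x1, x2], ![y0, y1, y2]) ∈ S →
      y0 * ternaryQuad (D · 1) x0 x1 x2 + 2 * y1 * ternaryQuad (D · 3) x0 x1 x2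
        + y2 * ternaryQuad (D · 4) x0 x1 x2 = 0) ∧
    (∀ x0 x1 x2 y0 y1 y2, (![x0, x1, x2], ![y0, y1, y2]) ∈ S →
      y0 * ternaryQuad (D · 2) x0 x1 x2 + y1 * ternaryQuad (D · 4) x0 x1 x2
        + 2 * y2 * ternaryQuad (D · 5) x0 x1 x2 = 0) := by
  obtain ⟨D, hval⟩ := hF.1.exists_coeffs
  refine ⟨D, hval, ?_, ?_, ?_, ?_, ?_, ?_⟩ <;> intro x0 x1 x2 y0 y1 y2 hz
  on_goal 1 => have h := PB.add_left_eq_sub_left_of_eq_zero hF (h0 _ hz) ![1, 0, 0]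
  on_goal 2 => have h := PB.add_left_eq_sub_left_of_eq_zero hF (h0 _ hz) ![0, 1, 0]
  on_goal 3 => have h := PB.add_left_eq_sub_left_of_eq_zero hF (h0 _ hz) ![0, 0, 1]
  on_goal 4 => have h := PB.add_right_eq_sub_right_of_eq_zero hF (h0 _ hz) ![1, 0, 0]
  on_goal 5 => have h := PB.add_right_eq_sub_right_of_eq_zero hF (h0 _ hz) ![0, 1, 0]
  on_goal 6 => have h := PB.add_right_eq_sub_right_of_eq_zero hF (h0 _ hz) ![0, 0, 1]
  all_goals
    simp only [Matrix.add_cons, Matrix.sub_cons, Matrix.head_cons, Matrix.tail_cons,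
      Matrix.empty_add_empty, Matrix.empty_sub_empty, hval, ternaryQuad] at h
    simp only [ternaryQuad]
    linear_combination h / 2

/-- A nonnegative biquadratic form that vanishes at the nine points is a multiple of
`sigma exampleForm`. -/
theorem eq_smul_of_forall_nineZeros {F : (Fin 3 → ℝ) → (Fin 3 → ℝ) → ℝ} (hF : F ∈ PB 3 3)
    (h0 : ∀ z ∈ nineZeros (1 / 2) (3 / 4), F z.1 z.2 = 0) :
    ∃ c : ℝ, 0 ≤ c ∧ F = c • sigma exampleForm := by
  obtain ⟨D, hval, gx0, gx1, gx2, gy0, gy1, gy2⟩ := exists_coeffs_and_gradient hF h0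
  simp only [ternaryQuad] at gx0 gx1 gx2 gy0 gy1 gy2
  have m0 : (![1, 1, 1], ![1, 1, 1]) ∈ nineZeros (1 / 2) (3 / 4) := by simp [nineZeros]
  have m1 : (![1, 1, -1], ![1, 1, -1]) ∈ nineZeros (1 / 2) (3 / 4) := by simp [nineZeros]
  have m2 : (![1, -1, 1], ![1, -1, 1]) ∈ nineZeros (1 / 2) (3 / 4) := by simp [nineZeros]
  have m3 : (![-1, 1, 1], ![-1, 1, 1]) ∈ nineZeros (1 / 2) (3 / 4) := by simp [nineZeros]
  have m4 : (![1, 1 / 2, 0], ![3 / 4, 1, 0]) ∈ nineZeros (1 / 2) (3 / 4) := by simp [nineZeros]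
  have m5 : (![1, -(1 / 2), 0], ![-(3 / 4), 1, 0]) ∈ nineZeros (1 / 2) (3 / 4) := by
    simp [nineZeros]
  have m6 : (![0, 1, 3 / 4], ![0, 1 / 2, 1]) ∈ nineZeros (1 / 2) (3 / 4) := by simp [nineZeros]
  have m7 : (![0, 1, -(3 / 4)], ![0, -(1 / 2), 1]) ∈ nineZeros (1 / 2) (3 / 4) := by
    simp [nineZeros]
  have m8 : (![0, 0, 1], ![1, 0, 0]) ∈ nineZeros (1 / 2) (3 / 4) := by simp [nineZeros]
  -- `hkxi` and `hkyi` are the partial derivatives at the `k`-th zero. By Euler's identity the `x`-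
  -- and `y`-gradients satisfy `x · ∇ₓF = y · ∇ᵧF`, so at the last five zeros one `y`-derivative,
  -- where the coordinate of `y` is `1`, is redundant and omitted.
  have h0x0 := gx0 1 1 1 1 1 1 m0
  have h0x1 := gx1 1 1 1 1 1 1 m0
  have h0x2 := gx2 1 1 1 1 1 1 m0
  have h0y0 := gy0 1 1 1 1 1 1 m0
  have h0y1 := gy1 1 1 1 1 1 1 m0
  have h0y2 := gy2 1 1 1 1 1 1 m0
  have h1x0 := gx0 1 1 (-1) 1 1 (-1) m1
  have h1x1 := gx1 1 1 (-1) 1 1 (-1) m1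
  have h1x2 := gx2 1 1 (-1) 1 1 (-1) m1
  have h1y0 := gy0 1 1 (-1) 1 1 (-1) m1
  have h1y1 := gy1 1 1 (-1) 1 1 (-1) m1
  have h1y2 := gy2 1 1 (-1) 1 1 (-1) m1
  have h2x0 := gx0 1 (-1) 1 1 (-1) 1 m2
  have h2x1 := gx1 1 (-1) 1 1 (-1) 1 m2
  have h2x2 := gx2 1 (-1) 1 1 (-1) 1 m2
  have h2y0 := gy0 1 (-1) 1 1 (-1) 1 m2
  have h2y1 := gy1 1 (-1) 1 1 (-1) 1 m2
  have h2y2 := gy2 1 (-1) 1 1 (-1) 1 m2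
  have h3x0 := gx0 (-1) 1 1 (-1) 1 1 m3
  have h3x1 := gx1 (-1) 1 1 (-1) 1 1 m3
  have h3x2 := gx2 (-1) 1 1 (-1) 1 1 m3
  have h3y0 := gy0 (-1) 1 1 (-1) 1 1 m3
  have h3y1 := gy1 (-1) 1 1 (-1) 1 1 m3
  have h3y2 := gy2 (-1) 1 1 (-1) 1 1 m3
  have h4x0 := gx0 1 (1 / 2) 0 (3 / 4) 1 0 m4
  have h4x1 := gx1 1 (1 / 2) 0 (3 / 4) 1 0 m4
  have h4x2 := gx2 1 (1 / 2) 0 (3 / 4) 1 0 m4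
  have h4y0 := gy0 1 (1 / 2) 0 (3 / 4) 1 0 m4
  have h4y2 := gy2 1 (1 / 2) 0 (3 / 4) 1 0 m4
  have h5x0 := gx0 1 (-(1 / 2)) 0 (-(3 / 4)) 1 0 m5
  have h5x1 := gx1 1 (-(1 / 2)) 0 (-(3 / 4)) 1 0 m5
  have h5x2 := gx2 1 (-(1 / 2)) 0 (-(3 / 4)) 1 0 m5
  have h5y0 := gy0 1 (-(1 / 2)) 0 (-(3 / 4)) 1 0 m5
  have h5y2 := gy2 1 (-(1 / 2)) 0 (-(3 / 4)) 1 0 m5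
  have h6x0 := gx0 0 1 (3 / 4) 0 (1 / 2) 1 m6
  have h6x1 := gx1 0 1 (3 / 4) 0 (1 / 2) 1 m6
  have h6x2 := gx2 0 1 (3 / 4) 0 (1 / 2) 1 m6
  have h6y0 := gy0 0 1 (3 / 4) 0 (1 / 2) 1 m6
  have h6y1 := gy1 0 1 (3 / 4) 0 (1 / 2) 1 m6
  have h7x0 := gx0 0 1 (-(3 / 4)) 0 (-(1 / 2)) 1 m7
  have h7x1 := gx1 0 1 (-(3 / 4)) 0 (-(1 / 2)) 1 m7
  have h7x2 := gx2 0 1 (-(3 / 4)) 0 (-(1 / 2)) 1 m7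
  have h7y0 := gy0 0 1 (-(3 / 4)) 0 (-(1 / 2)) 1 m7
  have h7y1 := gy1 0 1 (-(3 / 4)) 0 (-(1 / 2)) 1 m7
  have h8x0 := gx0 0 0 1 1 0 0 m8
  have h8x1 := gx1 0 0 1 1 0 0 m8
  have h8x2 := gx2 0 0 1 1 0 0 m8
  have h8y1 := gy1 0 0 1 1 0 0 m8
  have h8y2 := gy2 0 0 1 1 0 0 m8
  -- Sums and differences over zeros related by simultaneous sign changes of `x` and `y` separate
  -- the coefficients by parity: each `k` equation involves only one of four parity classes.
  have k0 : D 2 0 = 0 := by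
    linear_combination h8x0
  have k1 : D 4 0 = 0 := by
    linear_combination h8x1
  have k2 : 2 * D 5 0 = 0 := by
    linear_combination h8x2
  have k3 : D 5 1 = 0 := by
    linear_combination h8y1
  have k4 : D 5 2 = 0 := by
    linear_combination h8y2
  have k5 : 2 * D 0 4 + D 1 2 + D 2 1 = 0 := by
    linear_combination 1 / 4 * h0x0 - 1 / 4 * h1x0 - 1 / 4 * h2x0 - 1 / 4 * h3x0
  have k6 : D 1 4 + 2 * D 3 2 + D 4 1 = 0 := by
    linear_combination 1 / 4 * h0x1 - 1 / 4 * h1x1 - 1 / 4 * h2x1 - 1 / 4 * h3x1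
  have k7 : D 2 4 + D 4 2 + 2 * D 5 1 = 0 := by
    linear_combination 1 / 4 * h0x2 - 1 / 4 * h1x2 - 1 / 4 * h2x2 - 1 / 4 * h3x2
  have k8 : D 1 2 + D 2 1 + 2 * D 4 0 = 0 := by
    linear_combination 1 / 4 * h0y0 - 1 / 4 * h1y0 - 1 / 4 * h2y0 - 1 / 4 * h3y0
  have k9 : D 1 4 + 2 * D 2 3 + D 4 1 = 0 := by
    linear_combination 1 / 4 * h0y1 - 1 / 4 * h1y1 - 1 / 4 * h2y1 - 1 / 4 * h3y1
  have k10 : 2 * D 1 5 + D 2 4 + D 4 2 = 0 := by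
    linear_combination 1 / 4 * h0y2 - 1 / 4 * h1y2 - 1 / 4 * h2y2 - 1 / 4 * h3y2
  have k11 : 9 / 8 * D 0 0 + 2 * D 0 3 + 3 / 8 * D 1 1 = 0 := by
    linear_combination 1 / 2 * h4x0 + 1 / 2 * h5x0
  have k12 : 3 / 2 * D 0 1 + 9 / 32 * D 1 0 + 1 / 2 * D 1 3 = 0 := by
    linear_combination 1 / 2 * h4x0 - 1 / 2 * h5x0
  have k13 : 3 / 4 * D 1 1 + 9 / 16 * D 3 0 + D 3 3 = 0 := by
    linear_combination 1 / 2 * h4x1 - 1 / 2 * h5x1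
  have k14 : 9 / 16 * D 1 0 + D 1 3 + 3 / 4 * D 3 1 = 0 := by
    linear_combination 1 / 2 * h4x1 + 1 / 2 * h5x1
  have k15 : 9 / 16 * D 2 0 + D 2 3 + 3 / 8 * D 4 1 = 0 := by
    linear_combination 1 / 2 * h4x2 + 1 / 2 * h5x2
  have k16 : 3 / 4 * D 2 1 + 9 / 32 * D 4 0 + 1 / 2 * D 4 3 = 0 := by
    linear_combination 1 / 2 * h4x2 - 1 / 2 * h5x2
  have k17 : 3 / 2 * D 0 0 + 1 / 2 * D 1 1 + 3 / 8 * D 3 0 = 0 := by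
    linear_combination 1 / 2 * h4y0 - 1 / 2 * h5y0
  have k18 : D 0 1 + 3 / 4 * D 1 0 + 1 / 4 * D 3 1 = 0 := by
    linear_combination 1 / 2 * h4y0 + 1 / 2 * h5y0
  have k19 : 3 / 4 * D 0 2 + 1 / 2 * D 1 4 + 3 / 16 * D 3 2 = 0 := by
    linear_combination 1 / 2 * h4y2 - 1 / 2 * h5y2
  have k20 : D 0 4 + 3 / 8 * D 1 2 + 1 / 4 * D 3 4 = 0 := by
    linear_combination 1 / 2 * h4y2 + 1 / 2 * h5y2
  have k21 : 1 / 4 * D 1 3 + D 1 5 + 3 / 8 * D 2 4 = 0 := by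
    linear_combination 1 / 2 * h6x0 + 1 / 2 * h7x0
  have k22 : 1 / 2 * D 1 4 + 3 / 16 * D 2 3 + 3 / 4 * D 2 5 = 0 := by
    linear_combination 1 / 2 * h6x0 - 1 / 2 * h7x0
  have k23 : 1 / 2 * D 3 3 + 2 * D 3 5 + 3 / 8 * D 4 4 = 0 := by
    linear_combination 1 / 2 * h6x1 + 1 / 2 * h7x1
  have k24 : D 3 4 + 3 / 16 * D 4 3 + 3 / 4 * D 4 5 = 0 := by
    linear_combination 1 / 2 * h6x1 - 1 / 2 * h7x1
  have k25 : 1 / 2 * D 4 4 + 3 / 8 * D 5 3 + 3 / 2 * D 5 5 = 0 := by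
    linear_combination 1 / 2 * h6x2 - 1 / 2 * h7x2
  have k26 : 1 / 4 * D 4 3 + D 4 5 + 3 / 4 * D 5 4 = 0 := by
    linear_combination 1 / 2 * h6x2 + 1 / 2 * h7x2
  have k27 : 1 / 2 * D 3 1 + 3 / 4 * D 4 2 + 9 / 32 * D 5 1 = 0 := by
    linear_combination 1 / 2 * h6y0 - 1 / 2 * h7y0
  have k28 : D 3 3 + 3 / 4 * D 4 4 + 9 / 16 * D 5 3 = 0 := by
    linear_combination 1 / 2 * h6y1 - 1 / 2 * h7y1
  have k29 : D 3 4 + 3 / 4 * D 4 3 + 9 / 16 * D 5 4 = 0 := by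
    linear_combination 1 / 2 * h6y1 + 1 / 2 * h7y1
  have k30 : 2 * D 0 0 + 2 * D 0 3 + 2 * D 0 5 + D 1 1 + D 2 2 = 0 := by
    linear_combination 1 / 4 * h0x0 + 1 / 4 * h1x0 + 1 / 4 * h2x0 - 1 / 4 * h3x0
  have k31 : 2 * D 0 2 + D 1 4 + D 2 0 + D 2 3 + D 2 5 = 0 := by
    linear_combination 1 / 4 * h0x0 - 1 / 4 * h1x0 + 1 / 4 * h2x0 + 1 / 4 * h3x0
  have k32 : D 1 1 + 2 * D 3 0 + 2 * D 3 3 + 2 * D 3 5 + D 4 4 = 0 := by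
    linear_combination 1 / 4 * h0x1 + 1 / 4 * h1x1 - 1 / 4 * h2x1 + 1 / 4 * h3x1
  have k33 : D 2 2 + D 4 4 + 2 * D 5 0 + 2 * D 5 3 + 2 * D 5 5 = 0 := by
    linear_combination 1 / 4 * h0x2 - 1 / 4 * h1x2 + 1 / 4 * h2x2 + 1 / 4 * h3x2
  have k34 : 2 * D 0 0 + D 1 1 + D 2 2 + 2 * D 3 0 + 2 * D 5 0 = 0 := by
    linear_combination 1 / 4 * h0y0 + 1 / 4 * h1y0 + 1 / 4 * h2y0 - 1 / 4 * h3y0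
  -- Solving each class: the 24 coefficients in the three odd classes, and `D 5 0`, vanish; every
  -- other even coefficient is a fixed multiple of `D 0 0`.
  have d01 : D 0 1 = 0 := by
    linear_combination -5 / 8 * k3 + 1 / 5 * k7 - 4 / 5 * k10 + 7 / 15 * k12 - 19 / 30 * k14 +
      3 / 10 * k18 + 8 / 5 * k21 + 4 / 5 * k27
  have d02 : D 0 2 = 0 := by
    linear_combination -1 / 6 * k0 + 7 / 24 * k6 + 17 / 24 * k9 - 8 / 3 * k15 - 28 / 9 * k19 -
      20 / 9 * k22 + 5 / 3 * k31
  have d03 : D 0 3 = 27 / 100 * D 0 0 := by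
    linear_combination 1 / 2 * k11 - 9 / 100 * k13 - 93 / 200 * k17 - 9 / 50 * k23 -
      9 / 100 * k25 - 9 / 50 * k28 + 9 / 50 * k32 + 27 / 400 * k33 - 27 / 400 * k34
  have d04 : D 0 4 = 0 := by
    linear_combination k1 + 1 / 2 * k5 - 1 / 2 * k8
  have d05 : D 0 5 = 33 / 20 * D 0 0 := by
    linear_combination 1 / 2 * k2 - 1 / 2 * k11 - 11 / 20 * k13 - 7 / 40 * k17 - 11 / 10 * k23 -
      11 / 20 * k25 - 11 / 10 * k28 + 1 / 2 * k30 + 11 / 10 * k32 + 33 / 80 * k33 - 73 / 80 * k34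
  have d10 : D 1 0 = 0 := by
    linear_combination 5 / 3 * k3 - 8 / 15 * k7 + 32 / 15 * k10 - 16 / 45 * k12 + 56 / 45 * k14
      + 8 / 15 * k18 - 64 / 15 * k21 - 32 / 15 * k27
  have d11 : D 1 1 = (-111 / 25) * D 0 0 := by
    linear_combination 12 / 25 * k13 + 62 / 25 * k17 + 24 / 25 * k23 + 12 / 25 * k25 +
      24 / 25 * k28 - 24 / 25 * k32 - 9 / 25 * k33 + 9 / 25 * k34
  have d12 : D 1 2 = 0 := by
    linear_combination -79 / 24 * k1 - 32 / 15 * k5 + 23 / 15 * k8 + 4 / 5 * k16 + 64 / 15 * k20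
      - 8 / 15 * k24 + 2 / 5 * k26 - 8 / 15 * k29
  have d13 : D 1 3 = 0 := by
    linear_combination 15 / 16 * k3 - 3 / 10 * k7 + 6 / 5 * k10 + 4 / 5 * k12 + 6 / 5 * k14 -
      6 / 5 * k18 - 12 / 5 * k21 - 6 / 5 * k27
  have d14 : D 1 4 = 0 := by
    linear_combination 7 / 10 * k0 - 2 / 5 * k6 - 1 / 5 * k9 + 8 / 5 * k15 + 64 / 15 * k19 +
      32 / 15 * k22 - 8 / 5 * k31
  have d15 : D 1 5 = 0 := by
    linear_combination k3 - 1 / 2 * k7 + 1 / 2 * k10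
  have d20 : D 2 0 = 0 := by
    linear_combination k0
  have d21 : D 2 1 = 0 := by
    linear_combination 31 / 24 * k1 + 32 / 15 * k5 - 8 / 15 * k8 - 4 / 5 * k16 - 64 / 15 * k20 +
      8 / 15 * k24 - 2 / 5 * k26 + 8 / 15 * k29
  have d22 : D 2 2 = (-7 / 5) * D 0 0 := by
    linear_combination -k2 + 4 / 5 * k13 - 6 / 5 * k17 + 8 / 5 * k23 + 4 / 5 * k25 + 8 / 5 * k28
      - 8 / 5 * k32 - 3 / 5 * k33 + 8 / 5 * k34
  have d23 : D 2 3 = 0 := by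
    linear_combination -6 / 5 * k0 - 3 / 5 * k6 - 9 / 5 * k9 + 32 / 5 * k15 + 32 / 5 * k19 +
      16 / 5 * k22 - 12 / 5 * k31
  have d24 : D 2 4 = 0 := by
    linear_combination -79 / 24 * k3 + 23 / 15 * k7 - 32 / 15 * k10 - 8 / 15 * k12 - 4 / 5 * k14
      + 4 / 5 * k18 + 64 / 15 * k21 + 4 / 5 * k27
  have d25 : D 2 5 = 0 := by
    linear_combination -1 / 6 * k0 + 5 / 12 * k6 + 7 / 12 * k9 - 8 / 3 * k15 - 40 / 9 * k19 -
      8 / 9 * k22 + 5 / 3 * k31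
  have d30 : D 3 0 = 48 / 25 * D 0 0 := by
    linear_combination -16 / 25 * k13 - 16 / 25 * k17 - 32 / 25 * k23 - 16 / 25 * k25 -
      32 / 25 * k28 + 32 / 25 * k32 + 12 / 25 * k33 - 12 / 25 * k34
  have d31 : D 3 1 = 0 := by
    linear_combination -5 / 2 * k3 + 4 / 5 * k7 - 16 / 5 * k10 - 4 / 5 * k12 - 6 / 5 * k14 +
      6 / 5 * k18 + 32 / 5 * k21 + 16 / 5 * k27
  have d32 : D 3 2 = 0 := by
    linear_combination -6 / 5 * k0 - 1 / 10 * k6 - 23 / 10 * k9 + 32 / 5 * k15 + 32 / 5 * k19 +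
      16 / 5 * k22 - 12 / 5 * k31
  have d33 : D 3 3 = 9 / 4 * D 0 0 := by
    linear_combination k13 - 3 / 2 * k17
  have d34 : D 3 4 = 0 := by
    linear_combination 15 / 16 * k1 + 6 / 5 * k5 - 3 / 10 * k8 - 6 / 5 * k16 - 12 / 5 * k20 +
      4 / 5 * k24 - 3 / 5 * k26 + 4 / 5 * k29
  have d35 : D 3 5 = 27 / 100 * D 0 0 := by
    linear_combination -1 / 25 * k13 + 3 / 50 * k17 + 8 / 25 * k23 - 6 / 25 * k25 -
      12 / 25 * k28 + 9 / 50 * k32 + 9 / 50 * k33 - 9 / 50 * k34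
  have d40 : D 4 0 = 0 := by
    linear_combination k1
  have d41 : D 4 1 = 0 := by
    linear_combination 17 / 10 * k0 + 8 / 5 * k6 + 24 / 5 * k9 - 72 / 5 * k15 - 256 / 15 * k19 -
      128 / 15 * k22 + 32 / 5 * k31
  have d42 : D 4 2 = 0 := by
    linear_combination 31 / 24 * k3 - 8 / 15 * k7 + 32 / 15 * k10 + 8 / 15 * k12 + 4 / 5 * k14 -
      4 / 5 * k18 - 64 / 15 * k21 - 4 / 5 * k27
  have d43 : D 4 3 = 0 := by
    linear_combination -5 / 2 * k1 - 16 / 5 * k5 + 4 / 5 * k8 + 16 / 5 * k16 + 32 / 5 * k20 -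
      4 / 5 * k24 + 3 / 5 * k26 - 4 / 5 * k29
  have d44 : D 4 4 = (-111 / 25) * D 0 0 := by
    linear_combination -28 / 25 * k13 + 42 / 25 * k17 + 24 / 25 * k23 + 32 / 25 * k25 +
      64 / 25 * k28 - 24 / 25 * k32 - 24 / 25 * k33 + 24 / 25 * k34
  have d45 : D 4 5 = 0 := by
    linear_combination -5 / 8 * k1 - 4 / 5 * k5 + 1 / 5 * k8 + 4 / 5 * k16 + 8 / 5 * k20 +
      7 / 15 * k24 + 13 / 20 * k26 - 13 / 15 * k29
  have d50 : D 5 0 = 0 := by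
    linear_combination 1 / 2 * k2
  have d51 : D 5 1 = 0 := by
    linear_combination k3
  have d52 : D 5 2 = 0 := by
    linear_combination k4
  have d53 : D 5 3 = 48 / 25 * D 0 0 := by
    linear_combination -64 / 225 * k13 + 32 / 75 * k17 - 32 / 25 * k23 - 128 / 75 * k25 -
      368 / 225 * k28 + 32 / 25 * k32 + 32 / 25 * k33 - 32 / 25 * k34
  have d54 : D 5 4 = 0 := by
    linear_combination 5 / 3 * k1 + 32 / 15 * k5 - 8 / 15 * k8 - 32 / 15 * k16 - 64 / 15 * k20 -
      16 / 45 * k24 + 4 / 15 * k26 + 64 / 45 * k29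
  have d55 : D 5 5 = D 0 0 := by
    linear_combination 4 / 9 * k13 - 2 / 3 * k17 + 2 / 3 * k25 - 4 / 9 * k28
  -- The coefficient of `(x₀ y₀)²` in `sigma exampleForm` is `100`; nonnegativity of the factor is
  -- read off from the value of `F` at the first unit vectors.
  refine ⟨D 0 0 / 100, ?_, ?_⟩
  · have h := hF.2 ![1, 0, 0] ![1, 0, 0]
    rw [hval] at h
    simp only [ternaryQuad] at h
    linarith
  · funext x y
    have hx : x = ![x 0, x 1, x 2] := by
      ext i
      fin_cases i <;> rfl
    have hy : y = ![y 0, y 1, y 2] := by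
      ext i
      fin_cases i <;> rfl
    rw [Pi.smul_apply, Pi.smul_apply, sigma_exampleForm, smul_eq_mul]
    conv_lhs => rw [hx, hy]
    rw [hval]
    simp only [ternaryQuad]
    rw [d01, d02, d03, d04, d05, d10, d11, d12, d13, d14, d15, d20, d21, d22, d23, d24, d25,
      d30, d31, d32, d33, d34, d35, d40, d41, d42, d43, d44, d45, d50, d51, d52, d53, d54, d55]
    ring

/-! ### Extremality of the form and refutation of the conjecture. -/

theorem isBuckleySivic_exampleForm : IsBuckleySivic (1 / 2) (3 / 4) (sigma exampleForm) := by
  refine ⟨⟨⟨coeffs exampleForm, fun x y => ?_⟩, sigma_exampleForm_nonneg⟩, fun h => ?_, ?_⟩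
  · rw [sigma, apply_eq_sum_coeffs]
    simp only [Matrix.vecMulVec_apply, mul_assoc]
  · have := congrFun (congrFun h ![1, 0, 0]) ![1, 0, 0]
    simp [sigma_exampleForm] at this
  · simp only [nineZeros, Set.mem_insert_iff, Set.mem_singleton_iff]
    rintro z (rfl | rfl | rfl | rfl | rfl | rfl | rfl | rfl | rfl) <;>
      simp [sigma_exampleForm] <;> norm_num

/-- Nonnegative summands of a form vanish wherever the form does, so both summands inherit the nine
zeros and are multiples of the same form. -/
theorem isStrongExtremal_exampleForm : IsStrongExtremal exampleForm := by
  obtain ⟨hmem, hne, hzero⟩ := isBuckleySivic_exampleForm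
  refine ⟨hmem, hne, fun f₁ h₁ f₂ h₂ h hli => ?_⟩
  have hsum : ∀ x y, sigma exampleForm x y = f₁ x y + f₂ x y := fun x y => by rw [h]; rfl
  have hz₁ : ∀ z ∈ nineZeros (1 / 2) (3 / 4), f₁ z.1 z.2 = 0 := fun z hz => by
    have := hsum z.1 z.2
    linarith [hzero z hz, h₁.2 z.1 z.2, h₂.2 z.1 z.2]
  have hz₂ : ∀ z ∈ nineZeros (1 / 2) (3 / 4), f₂ z.1 z.2 = 0 := fun z hz => by
    have := hsum z.1 z.2
    linarith [hzero z hz, h₁.2 z.1 z.2, h₂.2 z.1 z.2]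
  obtain ⟨c₁, -, e₁⟩ := eq_smul_of_forall_nineZeros h₁ hz₁
  obtain ⟨c₂, -, e₂⟩ := eq_smul_of_forall_nineZeros h₂ hz₂
  have hc := (LinearIndependent.pair_iff.1 hli) c₂ (-c₁) (by
    rw [e₁, e₂, smul_smul, smul_smul, ← add_smul]
    ring_nf
    simp)
  have hf₂ : f₂ ≠ 0 := by simpa using hli.ne_zero 1
  exact hf₂ (by rw [e₂, hc.1, zero_smul])

/-- A bilinear form whose square lies below vanishes at the nine zeros. These impose nine
independent linear conditions on the nine entries of `M`. -/
theorem isWeakExtremal_exampleForm : IsWeakExtremal exampleForm := by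
  intro M hM
  have hz : ∀ z ∈ nineZeros (1 / 2) (3 / 4), z.1 ⬝ᵥ M *ᵥ z.2 = 0 := fun z hz => by
    have h1 := hM z.1 z.2
    have h2 : exampleForm (Matrix.vecMulVec z.1 z.2) = 0 := isBuckleySivic_exampleForm.2.2 z hz
    rw [h2] at h1
    exact pow_eq_zero_iff two_ne_zero |>.1 (le_antisymm h1 (sq_nonneg _))
  simp only [nineZeros, Set.mem_insert_iff, Set.mem_singleton_iff, forall_eq_or_imp, forall_eq,
    dotProduct, Matrix.mulVec, Fin.sum_univ_three, Matrix.cons_val] at hz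
  obtain ⟨h1, h2, h3, h4, h5, h6, h7, h8, h9⟩ := hz
  ext i j
  fin_cases i <;> fin_cases j <;> simp only [Fin.reduceFinMk, Fin.zero_eta, Fin.mk_one,
    Fin.isValue, Matrix.zero_apply] <;> linarith

end QuasiconvexForms

open QuasiconvexForms in
theorem mainTheorem3 :
    (∃ Φ : QuasiconvexForms.Q 3 3,
      -- `σ(Φ)` is the Buckley–Šivic form with `p = 1/2`, `q = 3/4`, unique up to positive scaling
      QuasiconvexForms.IsBuckleySivic (1 / 2) (3 / 4) (QuasiconvexForms.sigma Φ) ∧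
      (∀ F, QuasiconvexForms.IsBuckleySivic (1 / 2) (3 / 4) F →
        ∃ c : ℝ, 0 < c ∧ F = c • QuasiconvexForms.sigma Φ) ∧
      QuasiconvexForms.xMatrix Φ = QuasiconvexForms.exampleTensor ∧
      -- `Φ` is quasiconvex and extremal in the strong and in the weak sense
      QuasiconvexForms.IsQuasiconvex Φ ∧
      QuasiconvexForms.IsStrongExtremal Φ ∧
      QuasiconvexForms.IsWeakExtremal Φ ∧
      -- the determinant of the acoustic tensor, in either variable, is a nonzero nonnegative
      -- ternary sextic that does not span an extreme ray
      ((QuasiconvexForms.xMatrix Φ).det ∈ QuasiconvexForms.ternarySextics ∧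
        (QuasiconvexForms.xMatrix Φ).det ≠ 0 ∧
        ¬ QuasiconvexForms.IsExtremeRay QuasiconvexForms.ternarySextics
          (QuasiconvexForms.xMatrix Φ).det) ∧
      ((QuasiconvexForms.yMatrix Φ).det ∈ QuasiconvexForms.ternarySextics ∧
        (QuasiconvexForms.yMatrix Φ).det ≠ 0 ∧
        ¬ QuasiconvexForms.IsExtremeRay QuasiconvexForms.ternarySextics
          (QuasiconvexForms.yMatrix Φ).det)) ∧
    ¬ QuasiconvexForms.DeterminantConjecture := by
  have hq := isQuasiconvex_of_sigma_nonneg sigma_exampleForm_nonneg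
  have hb := isBuckleySivic_exampleForm
  have hx : exampleTensor.det ∈ ternarySextics ∧ exampleTensor.det ≠ 0 ∧
      ¬ IsExtremeRay ternarySextics exampleTensor.det :=
    not_isExtremeRay_of_eval_eq_detCubic
      (xMatrix_exampleForm ▸ isHomogeneous_det (isHomogeneous_xMatrix exampleForm))
      (by decide) (by decide) (by decide) eval_det_exampleTensor
  have hy : exampleTensor'.det ∈ ternarySextics ∧ exampleTensor'.det ≠ 0 ∧
      ¬ IsExtremeRay ternarySextics exampleTensor'.det :=
    not_isExtremeRay_of_eval_eq_detCubic
      (yMatrix_exampleForm ▸ isHomogeneous_det (isHomogeneous_yMatrix exampleForm))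
      (by decide) (by decide) (by decide) eval_det_exampleTensor'
  rw [← xMatrix_exampleForm] at hx
  rw [← yMatrix_exampleForm] at hy
  refine ⟨⟨exampleForm, hb, fun F hF => ?_, xMatrix_exampleForm, hq,
    isStrongExtremal_exampleForm, isWeakExtremal_exampleForm, hx, hy⟩, fun hconj => ?_⟩
  · obtain ⟨c, hc, h⟩ := eq_smul_of_forall_nineZeros hF.1 hF.2.2
    refine ⟨c, hc.lt_of_ne' ?_, h⟩
    rintro rfl
    exact hF.2.1 (by rw [h, zero_smul])
  -- Only the extreme-ray half of the conjectured conclusion is contradicted; the clause about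
  -- perfect squares plays no role.
  · exact hx.2.2 (hconj exampleForm hq hb.2.1 isWeakExtremal_exampleForm).1
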